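/- Let $Z$ (controls) and $X$ (states) be real reflexive Banach spaces, let $U\subseteq Z$ be a nonempty weakly compact control set, and let $C\subseteq Z$ be a convex set with $U\subseteq C$ (for example $C=Z$, or $C=U$ if $U$ is convex). Consider the Hammerstein system $$x = KNx + Hu,\qquad u\in U,\ x\in X, \tag{1}$$ and a cost $\phi : C\times X\to\mathbb R$. Assume that either [A] or [B] holds. **[A]** $K:X^*\to X$ is linear and compact, and there is $d>0$ with $\langle Kf,f\rangle\ge d\|Kf\|^2$ for all $f\in X^*$; $N:X\to X^*$ is continuous, maps bounded sets to bounded sets, and is negatively monotone, i.e. $\langle Nx-Ny,x-y\rangle\le 0$ for all $x,y\in X$; $H:U\to X$ is completely continuous, i.e. $u_n\rightharpoonup u$ weakly with $u_n,u\in U$ implies $Hu_n\to Hu$ in norm. **[B]** $X$ is a real Hilbert space (identified with $X^*$). For $F:X\to X$ put $$\mu(F)=\inf_{x\ne y}\frac{\langle Fx-Fy,x-y\rangle}{\|x-y\|^2},\qquad \|F\|^*=\sup_{x\neq y}\frac{\|Fx-Fy\|}{\|x-y\|}.$$ (For $X=\{0\}$ both are taken to be $0$, so that [B] is not satisfied.)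 $K:X\to X$ is linear and there is $c>0$ with $\langle Kx-Ky,x-y\rangle\ge c\|x-y\|^2$ for all $x,y\in X$; $N:X\to X$ is globally Lipschitz, $\mu(-N)>0$ and $(\mu(K)+\mu(-N))\,(\|N\|^{*})^{-2}>0$; $H:U\to X$ is completely continuous in the sense above. Suppose further that for every $x\in X$ the map $u\mapsto\phi(u,x)$ is convex and norm continuous on $C$, and that $x\mapsto\phi(u,x)$ is continuous uniformly in $u\in U$, i.e. for every $x\in X$ and $\varepsilon>0$ there is $\delta>0$ such that $|\phi(u,y)-\phi(u,x)|<\varepsilon$ for all $u\in U$ and all $y\in X$ with $\|y-x\|<\delta$. Then for every $u\in U$ equation (1) has exactly one solution $x=Tu\in X$, and there is an optimal pair $(u^*,x^*)$: $u^*\in U$, $x^*=KNx^*+Hu^*$, and $\phi(u^*,x^*)\le\phi(u,x)$ for all $u\in U$ and $x\in X$ with $x=KNx+Hu$. -/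

import Mathlib

open Set Filter Topology

universe u v w

namespace Hammerstein

/-- A real normed space is reflexive if the canonical map into its bidual is onto. -/
def IsReflexive (Z : Type u) [NormedAddCommGroup Z] [NormedSpace ℝ Z] : Prop :=
  Function.Surjective (NormedSpace.inclusionInDoubleDual ℝ Z)

/-- Weak compactness of a subset of a normed space. -/
def IsWeaklyCompact {Z : Type u} [NormedAddCommGroup Z] [NormedSpace ℝ Z] (U : Set Z) : Prop :=
  IsCompact (toWeakSpace ℝ Z '' U)

/-- Weak convergence `uₙ ⇀ z` of a sequence in a normed space. -/
def WeakTendsto {Z : Type u} [NormedAddCommGroup Z] [NormedSpace ℝ Z]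
    (s : ℕ → Z) (z : Z) : Prop :=
  ∀ f : StrongDual ℝ Z, Tendsto (fun n => f (s n)) atTop (𝓝 (f z))

/-- `H` is completely continuous on `U`: it maps sequences of `U` that converge weakly to a point
of `U` to norm convergent sequences, with the corresponding limit. -/
def CompletelyContinuousOn {Z : Type u} {X : Type v}
    [NormedAddCommGroup Z] [NormedSpace ℝ Z] [NormedAddCommGroup X]
    (H : Z → X) (U : Set Z) : Prop :=
  ∀ (s : ℕ → Z) (z : Z), (∀ n, s n ∈ U) → z ∈ U → WeakTendsto s z →
    Tendsto (fun n => H (s n)) atTop (𝓝 (H z))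

/-- The Hammerstein state equation `x = K N x + H u`. -/
def StateEq {Z : Type u} {X : Type v} {Y : Type w} [Add X]
    (K : Y → X) (N : X → Y) (H : Z → X) (u : Z) (x : X) : Prop :=
  x = K (N x) + H u

/-- `(u, x)` is an optimal pair: `u` is a control in `U`, `x` is a state belonging to `u`, and the
cost of the pair is minimal among all such control-state pairs. -/
def IsOptimalPair {Z : Type u} {X : Type v} {Y : Type w} [Add X]
    (K : Y → X) (N : X → Y) (H : Z → X) (U : Set Z) (φ : Z → X → ℝ) (u : Z) (x : X) : Prop :=
  u ∈ U ∧ StateEq K N H u x ∧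
    ∀ u' ∈ U, ∀ x' : X, StateEq K N H u' x' → φ u x ≤ φ u' x'

/-- Conditions on the cost `φ(u, x)`: for fixed `x` it is convex and (norm) continuous in `u` on
the domain `C` of control arguments, and it is continuous in `x` uniformly for all `u` in the
control set `U`. -/
structure CostAssumption {Z : Type u} {X : Type v}
    [NormedAddCommGroup Z] [NormedSpace ℝ Z] [NormedAddCommGroup X]
    (C U : Set Z) (φ : Z → X → ℝ) : Prop where
  convex : ∀ x : X, ConvexOn ℝ C (fun u => φ u x)
  continuous_control : ∀ x : X, ContinuousOn (fun u => φ u x) C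
  continuous_state : ∀ x : X, ∀ ε > 0, ∃ δ > 0, ∀ u ∈ U, ∀ y : X,
    ‖y - x‖ < δ → |φ u y - φ u x| < ε

/-- Assumptions [A] (reflexive Banach state space `X`). -/
structure AssumptionA {Z : Type u} {X : Type v}
    [NormedAddCommGroup Z] [NormedSpace ℝ Z] [NormedAddCommGroup X] [NormedSpace ℝ X]
    (U : Set Z) (K : StrongDual ℝ X →ₗ[ℝ] X) (N : X → StrongDual ℝ X) (H : Z → X) : Prop where
  compact : IsCompactOperator K
  positive : ∃ d : ℝ, 0 < d ∧ ∀ f : StrongDual ℝ X, d * ‖K f‖ ^ 2 ≤ f (K f)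
  continuous : Continuous N
  /-- `N` maps bounded sets to bounded sets. -/
  bounded : ∀ S : Set X, Bornology.IsBounded S → Bornology.IsBounded (N '' S)
  /-- `-N` is monotone. -/
  negMonotone : ∀ x y : X, (N x - N y) (x - y) ≤ 0
  completelyContinuous : CompletelyContinuousOn H U

section Hilbert

variable {E : Type v} [NormedAddCommGroup E] [InnerProductSpace ℝ E]

/-- The class `M` of (strongly monotone) operators on a Hilbert space. -/
def ClassM (F : E → E) : Prop :=
  ∃ c : ℝ, 0 < c ∧ ∀ x y : E, c * ‖x - y‖ ^ 2 ≤ inner ℝ (F x - F y) (x - y)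

/-- `μ(F)`, the infimum of `⟨F x - F y, x - y⟩ / ‖x - y‖²` over `x ≠ y`. -/
noncomputable def mu (F : E → E) : ℝ :=
  sInf {r : ℝ | ∃ x y : E, x ≠ y ∧ r = inner ℝ (F x - F y) (x - y) / ‖x - y‖ ^ 2}

/-- The class `Lip` of (globally) Lipschitz operators. -/
def ClassLip (F : E → E) : Prop :=
  ∃ L : ℝ, ∀ x y : E, ‖F x - F y‖ ≤ L * ‖x - y‖

/-- `‖F‖*`, the supremum of `‖F x - F y‖ / ‖x - y‖` over `x ≠ y`. -/
noncomputable def lipNorm (F : E → E) : ℝ :=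
  sSup {r : ℝ | ∃ x y : E, x ≠ y ∧ r = ‖F x - F y‖ / ‖x - y‖}

end Hilbert

/-- Assumptions [B] (Hilbert state space `E`). -/
structure AssumptionB {Z : Type u} {E : Type v}
    [NormedAddCommGroup Z] [NormedSpace ℝ Z] [NormedAddCommGroup E] [InnerProductSpace ℝ E]
    (U : Set Z) (K : E →ₗ[ℝ] E) (N : E → E) (H : Z → E) : Prop where
  classM : ClassM (K : E → E)
  lipschitz : ClassLip N
  mu_neg_pos : 0 < mu (-N)
  balance : 0 < (mu (K : E → E) + mu (-N)) * (lipNorm N ^ 2)⁻¹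
  completelyContinuous : CompletelyContinuousOn H U

end Hammerstein

/-!
Both settings reduce to one: `K : X* → X` is linear with `d ‖K f‖² ≤ ⟨f, K f⟩`, and `N : X → X*` is
continuous, bounded on bounded sets and negatively monotone. In the Hilbert setting a strongly
monotone linear `K` is bounded by the closed graph theorem, so that
`d = c / (‖K‖² + 1)` will do (`ClassM.exists_mul_norm_sq_le`), and `X` is identified with `X*` by
Riesz.

Existence of states needs no topological fixed point theorem. The equation `x = K (N x)` says that
`(x, f)` with `f = N x` is a zero of `M (x, f) = (f - N x, K f - x)`, a monotone operator on `X × X*`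
defined everywhere. On a product of balls, weakly compact by reflexivity and Banach–Alaoglu, the
variational inequality for `M` has a solution: Minty's form of it asks for a common point of a family
of closed half-spaces, and finitely many of them meet by a separation argument in finite dimension
(`exists_mem_stdSimplex_forall_sum_nonneg`). A priori estimates put the solution in the interior of
both balls if the radii are chosen well, so it is a zero of `M` (`exists_eq_map_of_monotone`).

If `x`, `y` solve the equation with right-hand sides `h`, `k`, then
`d ‖(x - y) - (h - k)‖² ≤ ‖N x - N y‖ ‖h - k‖`. This yields uniqueness, and norm convergence of the
states along weakly convergent controls, as `H` is completely continuous. An optimal pair is then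
found by the direct method: a minimising sequence of controls has a weakly convergent subsequence by
the Eberlein–Šmulian theorem (`IsWeaklyCompact.exists_weakTendsto_subseq`), and the cost is lower
semicontinuous along it, since `φ (·, x)` is convex and norm continuous while `φ (u, ·)` is
continuous uniformly in `u` (`existsUnique_state_and_exists_isOptimalPair`).
-/

namespace Hammerstein

/-! ### Variational inequalities for monotone operators -/

/-- A matrix game whose payoff matrix has an entrywise nonnegative symmetric part has nonnegative
value. Otherwise a functional with nonnegative coefficients `c` separates the image of the simplex
from the nonnegative orthant, and playing `c` against itself gives a contradiction. -/
theorem exists_mem_stdSimplex_forall_sum_nonneg {ι : Type*} [Fintype ι] [Nonempty ι]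
    (a : ι → ι → ℝ) (ha : ∀ i j, 0 ≤ a i j + a j i) :
    ∃ l ∈ stdSimplex ℝ ι, ∀ i, 0 ≤ ∑ j, a i j * l j := by
  classical
  by_contra! hcon
  let A : (ι → ℝ) →ₗ[ℝ] (ι → ℝ) := Matrix.mulVecLin (Matrix.of a)
  have hA : ∀ l i, A l i = ∑ j, a i j * l j := fun l i => rfl
  have hAc : Continuous A := A.continuous_of_finiteDimensional
  let T : Set (ι → ℝ) := {v | ∀ i, 0 ≤ v i}
  have hTconv : Convex ℝ T := fun x hx y hy s t hs ht _ i =>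
    add_nonneg (mul_nonneg hs (hx i)) (mul_nonneg ht (hy i))
  have hTclosed : IsClosed T := by
    simp only [T, ofPred_forall]
    exact isClosed_iInter fun i => isClosed_le continuous_const (continuous_apply i)
  have hdisj : Disjoint (A '' stdSimplex ℝ ι) T := by
    rw [Set.disjoint_left]
    rintro _ ⟨l, hl, rfl⟩ hT
    obtain ⟨i, hi⟩ := hcon l hl
    exact absurd (hT i) (not_le.2 hi)
  obtain ⟨f, s, t, hfs, hst, hft⟩ := geometric_hahn_banach_compact_closed
    ((convex_stdSimplex ℝ ι).linear_image A) ((isCompact_stdSimplex ℝ ι).image hAc)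
    hTconv hTclosed hdisj
  have ht0 : t < 0 := by simpa using hft 0 (fun i => le_rfl)
  let c : ι → ℝ := fun i => f (Pi.single i 1)
  have hfc : ∀ v : ι → ℝ, f v = ∑ i, v i * c i := by
    intro v
    conv_lhs => rw [pi_eq_sum_univ' v]
    simp [c, map_sum]
  -- A linear functional bounded below on the orthant is nonnegative there.
  have hc : ∀ i, 0 ≤ c i := by
    intro i
    by_contra! hci
    have h := hft ((t / c i) • Pi.single i 1) (fun j => by
      have h1 : 0 ≤ t / c i := (div_pos_of_neg_of_neg ht0 hci).le
      have h2 : 0 ≤ (Pi.single i 1 : ι → ℝ) j := by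
        rw [Pi.single_apply]; split_ifs <;> norm_num
      exact mul_nonneg h1 h2)
    rw [map_smul, smul_eq_mul, div_mul_cancel₀ t hci.ne] at h
    exact lt_irrefl _ h
  have hcsum : 0 < ∑ i, c i := by
    refine lt_of_le_of_ne (Finset.sum_nonneg fun i _ => hc i) fun h => ?_
    have hz : ∀ i, c i = 0 := fun i =>
      (Finset.sum_eq_zero_iff_of_nonneg fun i _ => hc i).1 h.symm i (Finset.mem_univ i)
    have := hfs _ ⟨_, single_mem_stdSimplex ℝ (Classical.arbitrary ι), rfl⟩
    rw [hfc] at this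
    simp only [hz, mul_zero, Finset.sum_const_zero] at this
    linarith
  have hl : (∑ i, c i)⁻¹ • c ∈ stdSimplex ℝ ι := by
    refine ⟨fun i => mul_nonneg (inv_nonneg.2 hcsum.le) (hc i), ?_⟩
    simp only [Pi.smul_apply, smul_eq_mul, ← Finset.mul_sum]
    exact inv_mul_cancel₀ hcsum.ne'
  have hneg : f (A c) < 0 := by
    have h := hfs _ ⟨_, hl, rfl⟩
    rw [map_smul, map_smul, smul_eq_mul] at h
    have h' : (∑ i, c i)⁻¹ * f (A c) < 0 := by linarith
    exact (pos_iff_neg_of_mul_neg h').1 (inv_pos.2 hcsum)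
  -- The quadratic form of `a` only sees its symmetric part.
  have hquad : f (A c) = ∑ i, ∑ j, a i j * (c i * c j) := by
    rw [hfc]
    refine Finset.sum_congr rfl fun i _ => ?_
    rw [hA, Finset.sum_mul]
    exact Finset.sum_congr rfl fun j _ => by ring
  have hquad' : f (A c) = ∑ i, ∑ j, a j i * (c i * c j) := by
    rw [hquad, Finset.sum_comm]
    exact Finset.sum_congr rfl fun i _ => Finset.sum_congr rfl fun j _ => by ring
  have : 0 ≤ f (A c) + f (A c) := by
    nth_rewrite 1 [hquad]
    rw [hquad', ← Finset.sum_add_distrib]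
    refine Finset.sum_nonneg fun i _ => ?_
    rw [← Finset.sum_add_distrib]
    refine Finset.sum_nonneg fun j _ => ?_
    rw [← add_mul]
    exact mul_nonneg (ha i j) (mul_nonneg (hc i) (hc j))
  linarith

/-- Minty's inequality on a compact convex set. Finitely many of the inequalities hold at a common
point by `exists_mem_stdSimplex_forall_sum_nonneg`, where the matrix `M yᵢ (yᵢ - yⱼ)` has nonnegative
symmetric part by monotonicity. The compact topology lives on a copy `W` of the vector space, so
that `D` may be weakly compact while `V` keeps its own topology. -/
theorem exists_minty_of_compact {V W : Type*} [AddCommGroup V] [Module ℝ V] [TopologicalSpace W]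
    {S : Set W} (hS : IsCompact S) (p : W → V) {D : Set V} (hD : p '' S = D)
    (hconv : Convex ℝ D) (hne : D.Nonempty) (M : V → V →ₗ[ℝ] ℝ)
    (hcont : ∀ y ∈ D, Continuous fun w => M y (p w))
    (hmono : ∀ y ∈ D, ∀ z ∈ D, 0 ≤ (M y - M z) (y - z)) :
    ∃ z ∈ D, ∀ y ∈ D, 0 ≤ M y (y - z) := by
  have key : (S ∩ ⋂ y : D, {w | 0 ≤ M y (y - p w)}).Nonempty := by
    refine hS.inter_iInter_nonempty _ (fun y => ?_) fun F => ?_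
    · simp only [map_sub]
      exact isClosed_le continuous_const (continuous_const.sub (hcont y y.2))
    · rcases F.eq_empty_or_nonempty with rfl | hF
      · obtain ⟨_, w, hw, rfl⟩ := hD ▸ hne
        exact ⟨w, hw, by simp⟩
      · have : Nonempty F := hF.to_subtype
        obtain ⟨l, hl, hpos⟩ := exists_mem_stdSimplex_forall_sum_nonneg
          (fun i j : F => M i.1 (i.1 - j.1 : V)) (fun i j => by
            have h := hmono i.1 i.1.2 j.1 j.1.2
            simp only [LinearMap.sub_apply, map_sub] at h ⊢
            linarith)
        have hz : ∑ j : F, l j • (j.1 : V) ∈ D :=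
          hconv.sum_mem (fun j _ => hl.1 j) hl.2 fun j _ => j.1.2
        obtain ⟨w, hw, hwz⟩ := hD.superset hz
        refine ⟨w, hw, mem_iInter₂.2 fun i hi => ?_⟩
        have h := hpos ⟨i, hi⟩
        have hsum : (i : V) - p w = ∑ j : F, l j • ((i : V) - (j.1 : V)) := by
          simp only [smul_sub, Finset.sum_sub_distrib, ← Finset.sum_smul, hl.2, one_smul, hwz]
        simp only [mem_ofPred_eq, hsum, map_sum, map_smul, smul_eq_mul]
        exact h.trans_eq (Finset.sum_congr rfl fun j _ => mul_comm _ _)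
  obtain ⟨w, hw, hwM⟩ := key
  exact ⟨p w, hD ▸ mem_image_of_mem p hw, fun y hy => mem_iInter.1 hwM ⟨y, hy⟩⟩

/-- Hartman–Stampacchia for monotone operators: a solution of Minty's inequality solves the
variational inequality, by continuity along segments. -/
theorem exists_variational_ineq_of_compact {V W : Type*} [AddCommGroup V] [Module ℝ V]
    [TopologicalSpace W]
    {S : Set W} (hS : IsCompact S) (p : W → V) {D : Set V} (hD : p '' S = D)
    (hconv : Convex ℝ D) (hne : D.Nonempty) (M : V → V →ₗ[ℝ] ℝ)
    (hcont : ∀ y ∈ D, Continuous fun w => M y (p w))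
    (hmono : ∀ y ∈ D, ∀ z ∈ D, 0 ≤ (M y - M z) (y - z))
    (hhemi : ∀ z v : V, Continuous fun t : ℝ => M (z + t • v) v) :
    ∃ z ∈ D, ∀ y ∈ D, 0 ≤ M z (y - z) := by
  obtain ⟨z, hz, hM⟩ := exists_minty_of_compact hS p hD hconv hne M hcont hmono
  refine ⟨z, hz, fun y hy => ?_⟩
  have hlim : Tendsto (fun t : ℝ => M (z + t • (y - z)) (y - z)) (𝓝[>] 0) (𝓝 (M z (y - z))) := by
    have h := (hhemi z (y - z)).tendsto 0
    simp only [zero_smul, add_zero] at h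
    exact h.mono_left nhdsWithin_le_nhds
  refine ge_of_tendsto hlim ?_
  filter_upwards [Ioo_mem_nhdsGT (zero_lt_one' ℝ)] with t ht
  have h := hM (z + t • (y - z)) (hconv.add_smul_sub_mem hz hy ⟨ht.1.le, ht.2.le⟩)
  rw [add_sub_cancel_left, map_smul, smul_eq_mul] at h
  exact nonneg_of_mul_nonneg_right h ht.1

/-- Closed balls of a reflexive space are weakly compact: Banach–Alaoglu in the bidual. -/
theorem IsReflexive.isCompact_weak_closedBall {X : Type v} [NormedAddCommGroup X] [NormedSpace ℝ X]
    (hX : IsReflexive X) (R : ℝ) :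
    IsCompact ((toWeakSpace ℝ X).symm ⁻¹' Metric.closedBall (0 : X) R) := by
  have h := (NormedSpace.isEmbedding_inclusionInDoubleDualWeak ℝ X).isCompact_preimage'
    (WeakDual.isCompact_closedBall (𝕜 := ℝ) (0 : StrongDual ℝ (StrongDual ℝ X)) R) (fun ξ _ => by
      obtain ⟨x, hx⟩ := hX ξ.toStrongDual
      exact ⟨toWeakSpace ℝ X x, DFunLike.ext _ _ fun f => congrArg (fun g => g f) hx⟩)
  convert h using 1
  ext x
  simp only [mem_preimage, Metric.mem_closedBall, dist_zero_right]
  rw [← (NormedSpace.inclusionInDoubleDualLi ℝ (E := X)).norm_map]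
  rfl

/-! ### Existence for the Hammerstein equation -/

section StateEquation

variable {X : Type v} [NormedAddCommGroup X] [NormedSpace ℝ X]

/-- The operator `(x, f) ↦ (f - N x, K f - x)` from `X × X*` to its dual `X* × X** ⊇ X* × X`, acting
on pairs `(y, g)`. Its zeros are the solutions of `x = K f`, `f = N x`. -/
noncomputable def saddleOperator (K : StrongDual ℝ X →ₗ[ℝ] X) (N : X → StrongDual ℝ X)
    (z : X × StrongDual ℝ X) : X × StrongDual ℝ X →ₗ[ℝ] ℝ :=
  LinearMap.coprod (z.2 - N z.1 : StrongDual ℝ X).toLinearMap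
    (NormedSpace.inclusionInDoubleDual ℝ X (K z.2 - z.1)).toLinearMap

theorem saddleOperator_apply (K : StrongDual ℝ X →ₗ[ℝ] X) (N : X → StrongDual ℝ X)
    (z v : X × StrongDual ℝ X) :
    saddleOperator K N z v = z.2 v.1 - N z.1 v.1 + (v.2 (K z.2) - v.2 z.1) := by
  simp [saddleOperator]

/-- The coupling terms `f` and `-x` cancel in the monotonicity pairing, leaving those of `K` and
`-N`. -/
theorem saddleOperator_monotone {K : StrongDual ℝ X →ₗ[ℝ] X} {N : X → StrongDual ℝ X}
    (hK : ∀ f : StrongDual ℝ X, 0 ≤ f (K f)) (hN : ∀ x y, (N x - N y) (x - y) ≤ 0)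
    (y z : X × StrongDual ℝ X) :
    0 ≤ (saddleOperator K N y - saddleOperator K N z) (y - z) := by
  have h1 := hK (y.2 - z.2)
  have h2 := hN y.1 z.1
  simp only [LinearMap.sub_apply, saddleOperator_apply, map_sub, sub_apply] at h1 h2 ⊢
  linarith

theorem mul_norm_le_of_forall_closedBall {F : Type*} [NormedAddCommGroup F] [NormedSpace ℝ F]
    {α : StrongDual ℝ F} {R c : ℝ} (hR : 0 < R)
    (h : ∀ y ∈ Metric.closedBall (0 : F) R, α y ≤ c) : R * ‖α‖ ≤ c := by
  have hc : 0 ≤ c := by simpa using h 0 (by simpa using hR.le)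
  have key : ∀ y : F, α y ≤ c / R * ‖y‖ := by
    intro y
    rcases eq_or_ne y 0 with rfl | hy
    · simp
    have hy' : 0 < ‖y‖ := norm_pos_iff.2 hy
    have h1 := h ((R / ‖y‖) • y) (by
      rw [mem_closedBall_zero_iff, norm_smul, Real.norm_of_nonneg (by positivity),
        div_mul_cancel₀ _ hy'.ne'])
    rw [map_smul, smul_eq_mul] at h1
    calc α y = (R / ‖y‖ * α y) * (‖y‖ / R) := by field_simp
      _ ≤ c * (‖y‖ / R) := mul_le_mul_of_nonneg_right h1 (by positivity)
      _ = c / R * ‖y‖ := by ring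
  rw [mul_comm, ← le_div_iff₀ hR]
  refine α.opNorm_le_bound (by positivity) fun y => abs_le'.2 ⟨key y, ?_⟩
  simpa using key (-y)

theorem eq_zero_of_isMaxOn_closedBall {F : Type*} [NormedAddCommGroup F] [NormedSpace ℝ F]
    {α : StrongDual ℝ F} {R : ℝ} {x : F} (hx : ‖x‖ < R)
    (h : ∀ y ∈ Metric.closedBall (0 : F) R, α y ≤ α x) : α = 0 := by
  have h1 := mul_norm_le_of_forall_closedBall ((norm_nonneg x).trans_lt hx) h
  have h2 := (le_abs_self _).trans (α.le_opNorm x)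
  by_contra hα
  have := mul_lt_mul_of_pos_right hx (norm_pos_iff.2 hα)
  linarith

/-- Existence for `x = K (N x)`. The variational inequality for `saddleOperator K N` is solved on a
product of balls of radii `R` in `X` and `S` in `X*`. The a priori estimates `‖N x - f‖ ≤ ‖N 0‖` and
`d ‖x‖ ≤ ‖N 0‖` place the solution `(x, f)` in the interior, where it is a zero of the operator. -/
theorem exists_eq_map_of_monotone (hX : IsReflexive X) {K : StrongDual ℝ X →ₗ[ℝ] X}
    {N : X → StrongDual ℝ X} {d : ℝ} (hd : 0 < d)
    (hK : ∀ f : StrongDual ℝ X, d * ‖K f‖ ^ 2 ≤ f (K f))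
    (hNc : Continuous N) (hNb : ∀ S : Set X, Bornology.IsBounded S → Bornology.IsBounded (N '' S))
    (hN : ∀ x y, (N x - N y) (x - y) ≤ 0) : ∃ x, x = K (N x) := by
  have hK0 : ∀ f : StrongDual ℝ X, 0 ≤ f (K f) := fun f =>
    (by positivity : 0 ≤ d * ‖K f‖ ^ 2).trans (hK f)
  -- `R` exceeds the a priori bound for `x`; `S` exceeds `‖N x‖ + ‖N x - f‖` for `‖x‖ ≤ R`.
  set R : ℝ := ‖N 0‖ / d + 1 with hR
  have hRpos : 0 < R := by positivity
  obtain ⟨B, hB⟩ := (hNb _ (Metric.isBounded_closedBall (x := (0 : X)) (r := R))).exists_norm_le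
  have hB : ∀ x : X, ‖x‖ ≤ R → ‖N x‖ ≤ B := fun x hx =>
    hB _ (mem_image_of_mem N (by simpa using hx))
  have hB0 : 0 ≤ B := (norm_nonneg _).trans (hB 0 (by simpa using hRpos.le))
  set S : ℝ := B + ‖N 0‖ + 1 with hS
  have hSpos : 0 < S := by positivity
  obtain ⟨⟨x, f⟩, hxf, hvi⟩ := exists_variational_ineq_of_compact
    ((hX.isCompact_weak_closedBall R).prod
      (WeakDual.isCompact_closedBall (𝕜 := ℝ) (0 : StrongDual ℝ X) S))
    (fun w => ((toWeakSpace ℝ X).symm w.1, WeakDual.toStrongDual w.2))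
    (D := Metric.closedBall (0 : X) R ×ˢ Metric.closedBall (0 : StrongDual ℝ X) S)
    (by
      ext ⟨y, g⟩
      constructor
      · rintro ⟨w, hw, h⟩
        rw [← h]
        exact hw
      · intro h
        exact ⟨(toWeakSpace ℝ X y, StrongDual.toWeakDual g), h, rfl⟩)
    ((convex_closedBall _ _).prod (convex_closedBall _ _))
    ⟨0, by simp [hRpos.le, hSpos.le]⟩
    (saddleOperator K N)
    (fun y _ => by
      simp only [saddleOperator_apply]
      have h1 : ∀ g : StrongDual ℝ X,
          Continuous fun w : WeakSpace ℝ X × WeakDual ℝ X => g ((toWeakSpace ℝ X).symm w.1) :=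
        fun g => (WeakBilin.eval_continuous (topDualPairing ℝ X).flip g).comp continuous_fst
      have h2 : ∀ x : X,
          Continuous fun w : WeakSpace ℝ X × WeakDual ℝ X => WeakDual.toStrongDual w.2 x :=
        fun x => (WeakDual.eval_continuous x).comp continuous_snd
      exact ((h1 _).sub (h1 _)).add ((h2 _).sub (h2 _)))
    (fun y _ z _ => saddleOperator_monotone hK0 hN y z)
    (fun z v => by
      simp only [saddleOperator_apply, Prod.fst_add, Prod.snd_add, Prod.smul_fst, Prod.smul_snd,
        map_add, map_smul]
      fun_prop)
  have hx : ‖x‖ ≤ R := mem_closedBall_zero_iff.1 hxf.1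
  -- Vary one of the two components at a time.
  have hα : ∀ y ∈ Metric.closedBall (0 : X) R, (N x - f) y ≤ (N x - f) x := by
    intro y hy
    have h := hvi (y, f) ⟨hy, hxf.2⟩
    simp only [saddleOperator_apply, Prod.mk_sub_mk, sub_self, zero_apply,
      map_sub, sub_apply] at h ⊢
    linarith
  have hβ : ∀ g ∈ Metric.closedBall (0 : StrongDual ℝ X) S, g (x - K f) ≤ f (x - K f) := by
    intro g hg
    have h := hvi (x, g) ⟨hxf.1, hg⟩
    simp only [saddleOperator_apply, Prod.mk_sub_mk, sub_self, map_zero,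
      map_sub, sub_apply] at h ⊢
    linarith
  have hα0 : 0 ≤ (N x - f) x := by simpa using hα 0 (by simpa using hRpos.le)
  have hβ0 : 0 ≤ f (x - K f) := by simpa using hβ 0 (by simpa using hSpos.le)
  have hN0 : N x x ≤ ‖N 0‖ * ‖x‖ := by
    have h1 := hN x 0
    have h2 := (le_abs_self _).trans ((N 0).le_opNorm x)
    simp only [sub_zero, sub_apply] at h1
    linarith
  have hKf := hK0 f
  have hexp : (N x - f) x = N x x - f (x - K f) - f (K f) := by
    simp only [map_sub, sub_apply]; ring
  have hαnorm : ‖N x - f‖ ≤ ‖N 0‖ := by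
    have h := mul_norm_le_of_forall_closedBall hRpos hα
    have h' : ‖N 0‖ * ‖x‖ ≤ ‖N 0‖ * R := mul_le_mul_of_nonneg_left hx (norm_nonneg _)
    refine le_of_mul_le_mul_left ?_ hRpos
    linarith
  have hfS : ‖f‖ < S := by
    have h1 := norm_sub_norm_le f (N x)
    rw [norm_sub_rev] at h1
    have h2 := hB x hx
    linarith
  -- An interior maximiser of a linear functional forces the functional to vanish.
  have hxK : x = K f := by
    have h := eq_zero_of_isMaxOn_closedBall
      (α := NormedSpace.inclusionInDoubleDual ℝ X (x - K f)) hfS hβ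
    have h' : ‖x - K f‖ = 0 := by
      rw [← (NormedSpace.inclusionInDoubleDualLi ℝ (E := X)).norm_map]
      exact norm_eq_zero.2 h
    exact sub_eq_zero.1 (norm_eq_zero.1 h')
  have hxR : ‖x‖ < R := by
    have h1 := hK f
    rw [← hxK] at h1 hexp
    simp only [sub_self, map_zero, sub_zero] at hexp
    have h2 : ‖x‖ * (d * ‖x‖) ≤ ‖x‖ * ‖N 0‖ := by linarith
    rcases (norm_nonneg x).eq_or_lt with h0 | h0
    · rwa [← h0]
    · have h3 : ‖x‖ ≤ ‖N 0‖ / d := by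
        rw [le_div_iff₀ hd]
        linarith [le_of_mul_le_mul_left h2 h0]
      linarith
  have hNf : N x = f := sub_eq_zero.1 (eq_zero_of_isMaxOn_closedBall hxR hα)
  exact ⟨x, by rw [hNf]; exact hxK⟩

end StateEquation

/-! ### Uniqueness and continuous dependence -/

section Stability

variable {X : Type v} [NormedAddCommGroup X] [NormedSpace ℝ X]

/-- Stability estimate for two right-hand sides `h`, `k`. -/
theorem mul_norm_sub_sq_le {K : StrongDual ℝ X →ₗ[ℝ] X} {N : X → StrongDual ℝ X} {d : ℝ}
    (hK : ∀ f : StrongDual ℝ X, d * ‖K f‖ ^ 2 ≤ f (K f))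
    (hN : ∀ x y, (N x - N y) (x - y) ≤ 0) {x y h k : X}
    (hx : x = K (N x) + h) (hy : y = K (N y) + k) :
    d * ‖(x - y) - (h - k)‖ ^ 2 ≤ ‖N x - N y‖ * ‖h - k‖ := by
  have hw : K (N x - N y) = (x - y) - (h - k) := by
    rw [map_sub]
    nth_rewrite 2 [hx]
    nth_rewrite 2 [hy]
    abel
  have h1 := hK (N x - N y)
  rw [hw, map_sub (N x - N y)] at h1
  have h2 := (neg_le_abs _).trans ((N x - N y).le_opNorm (h - k))
  linarith [hN x y]

/-- A priori bound for the solutions in terms of the right-hand side. -/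
theorem mul_norm_sub_le {K : StrongDual ℝ X →ₗ[ℝ] X} {N : X → StrongDual ℝ X} {d : ℝ}
    (hK : ∀ f : StrongDual ℝ X, d * ‖K f‖ ^ 2 ≤ f (K f))
    (hN : ∀ x y, (N x - N y) (x - y) ≤ 0) {x h : X} (hx : x = K (N x) + h) :
    d * ‖x - h‖ ≤ ‖N h‖ := by
  have h1 := hK (N x)
  rw [eq_sub_iff_add_eq.2 hx.symm] at h1
  have h2 := (le_abs_self _).trans ((N h).le_opNorm (x - h))
  have h3 := hN x h
  rw [sub_apply] at h3
  rcases (norm_nonneg (x - h)).eq_or_lt with h0 | h0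
  · rw [← h0, mul_zero]
    exact norm_nonneg _
  · refine le_of_mul_le_mul_right ?_ h0
    linarith

/-- The solution of `x = K (N x) + h` depends continuously on `h`. -/
theorem tendsto_of_tendsto_rhs {K : StrongDual ℝ X →ₗ[ℝ] X} {N : X → StrongDual ℝ X} {d : ℝ}
    (hd : 0 < d) (hK : ∀ f : StrongDual ℝ X, d * ‖K f‖ ^ 2 ≤ f (K f))
    (hNc : Continuous N) (hNb : ∀ S : Set X, Bornology.IsBounded S → Bornology.IsBounded (N '' S))
    (hN : ∀ x y, (N x - N y) (x - y) ≤ 0) {x h : ℕ → X} {x₀ h₀ : X}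
    (hx : ∀ n, x n = K (N (x n)) + h n) (hx₀ : x₀ = K (N x₀) + h₀)
    (hh : Tendsto h atTop (𝓝 h₀)) : Tendsto x atTop (𝓝 x₀) := by
  obtain ⟨a, ha⟩ := (Metric.isBounded_range_of_tendsto _ hh).exists_norm_le
  obtain ⟨b, hb⟩ :=
    (Metric.isBounded_range_of_tendsto _ ((hNc.tendsto h₀).comp hh)).exists_norm_le
  have hxb : ∀ n, ‖x n‖ ≤ b / d + a := fun n => by
    have h1 : ‖x n - h n‖ ≤ b / d := by
      rw [le_div_iff₀ hd, mul_comm]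
      exact (mul_norm_sub_le hK hN (hx n)).trans (hb _ (mem_range_self n))
    have h2 := norm_le_norm_sub_add (x n) (h n)
    linarith [ha _ (mem_range_self n)]
  obtain ⟨G, hG⟩ :=
    (hNb _ (Metric.isBounded_closedBall (x := (0 : X)) (r := b / d + a))).exists_norm_le
  have hdiff : Tendsto (fun n => h n - h₀) atTop (𝓝 0) := tendsto_sub_nhds_zero_iff.2 hh
  have hrem : Tendsto (fun n => (x n - x₀) - (h n - h₀)) atTop (𝓝 0) := by
    have hmaj : Tendsto (fun n => √((G + ‖N x₀‖) * ‖h n - h₀‖ / d)) atTop (𝓝 0) := by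
      have := ((hdiff.norm.const_mul (G + ‖N x₀‖)).div_const d).sqrt
      simpa using this
    refine squeeze_zero_norm (fun n => Real.le_sqrt_of_sq_le ?_) hmaj
    rw [le_div_iff₀ hd, mul_comm]
    refine (mul_norm_sub_sq_le hK hN (hx n) hx₀).trans
      (mul_le_mul_of_nonneg_right ?_ (norm_nonneg _))
    exact (norm_sub_le _ _).trans (add_le_add_left
      (hG _ (mem_image_of_mem N (by simpa using hxb n))) _)
  rw [← tendsto_sub_nhds_zero_iff]
  simpa using hrem.add hdiff

/-- Well-posedness of `x = K (N x) + h`: the substitution `y = x - h` reduces existence to the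
case `h = 0` with `N (· + h)` in place of `N`. -/
theorem existsUnique_eq_map_add (hX : IsReflexive X) {K : StrongDual ℝ X →ₗ[ℝ] X}
    {N : X → StrongDual ℝ X} {d : ℝ} (hd : 0 < d)
    (hK : ∀ f : StrongDual ℝ X, d * ‖K f‖ ^ 2 ≤ f (K f)) (hNc : Continuous N)
    (hNb : ∀ S : Set X, Bornology.IsBounded S → Bornology.IsBounded (N '' S))
    (hN : ∀ x y, (N x - N y) (x - y) ≤ 0) (h : X) : ∃! x, x = K (N x) + h := by
  obtain ⟨y, hy⟩ := exists_eq_map_of_monotone hX (N := fun y => N (y + h)) hd hK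
    (hNc.comp (continuous_add_const h))
    (fun S hS => by
      have hS' : Bornology.IsBounded ((fun y => y + h) '' S) :=
        (LipschitzWith.id.add (LipschitzWith.const h)).isBounded_image hS
      simpa only [image_image] using hNb _ hS')
    (fun x y => by simpa using hN (x + h) (y + h))
  refine ⟨y + h, congrArg (· + h) hy, fun x hx => ?_⟩
  have h1 := mul_norm_sub_sq_le hK hN hx (congrArg (· + h) hy : y + h = K (N (y + h)) + h)
  simp only [sub_self, norm_zero, mul_zero, sub_zero] at h1
  have h2 : ‖x - (y + h)‖ ^ 2 ≤ 0 := nonpos_of_mul_nonpos_right h1 hd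
  have h3 : ‖x - (y + h)‖ = 0 := by
    have := sq_nonneg ‖x - (y + h)‖
    exact pow_eq_zero_iff (two_ne_zero) |>.1 (le_antisymm h2 this)
  exact sub_eq_zero.1 (norm_eq_zero.1 h3)

end Stability

/-! ### Weak sequential compactness and lower semicontinuity -/

section WeakTopology

variable {Z : Type u} [NormedAddCommGroup Z] [NormedSpace ℝ Z]

/-- The separating functionals are norming for the points of a countable dense set. -/
theorem exists_separating_seq_of_isSeparable {Y : Set Z} (hne : Y.Nonempty)
    (hY : TopologicalSpace.IsSeparable Y) :
    ∃ g : ℕ → StrongDual ℝ Z, ∀ y ∈ Y, (∀ n, g n y = 0) → y = 0 := by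
  obtain ⟨c, hc, hYc⟩ := hY
  have hcne : c.Nonempty := closure_nonempty_iff.1 (hne.mono hYc)
  obtain ⟨e, rfl⟩ := hc.exists_eq_range hcne
  choose g hg1 hg2 using fun n => exists_dual_vector'' ℝ (e n)
  refine ⟨g, fun y hy h0 => ?_⟩
  by_contra hy0
  obtain ⟨_, ⟨n, rfl⟩, hn⟩ := Metric.mem_closure_iff.1 (hYc hy) (‖y‖ / 2)
    (half_pos (norm_pos_iff.2 hy0))
  rw [dist_eq_norm] at hn
  have h1 : ‖e n‖ ≤ ‖e n - y‖ := by
    have h2 : ‖e n‖ = g n (e n - y) := by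
      rw [map_sub, h0 n, sub_zero, hg2]
      rfl
    rw [h2]
    refine (le_abs_self _).trans (((g n).le_opNorm _).trans ?_)
    exact mul_le_of_le_one_left (norm_nonneg _) (hg1 n)
  have h3 := norm_le_norm_sub_add y (e n)
  rw [norm_sub_rev] at h1
  linarith

/-- The half of the Eberlein–Šmulian theorem giving sequential compactness. The sequence lies in a
closed separable subspace `Y`; on the weakly compact set `U ∩ Y` countably many functionals
separate points, so the weak topology there is metrizable. -/
theorem IsWeaklyCompact.exists_weakTendsto_subseq {U : Set Z} (hU : IsWeaklyCompact U)
    {s : ℕ → Z} (hs : ∀ n, s n ∈ U) :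
    ∃ z ∈ U, ∃ ψ : ℕ → ℕ, StrictMono ψ ∧ WeakTendsto (s ∘ ψ) z := by
  let Y : Submodule ℝ Z := (Submodule.span ℝ (range s)).topologicalClosure
  have hYsep : TopologicalSpace.IsSeparable (Y : Set Z) :=
    ((countable_range s).isSeparable.span (R := ℝ)).closure
  have hsY : ∀ n, s n ∈ Y := fun n =>
    Submodule.le_topologicalClosure _ (Submodule.subset_span (mem_range_self n))
  obtain ⟨g, hg⟩ := exists_separating_seq_of_isSeparable ⟨0, Y.zero_mem⟩ hYsep
  have hYclosed : IsClosed (toWeakSpace ℝ Z '' (Y : Set Z)) := by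
    rw [← closure_eq_iff_isClosed, ← Y.convex.toWeakSpace_closure ℝ,
      (Submodule.isClosed_topologicalClosure _).closure_eq]
  let Q : Set (WeakSpace ℝ Z) := toWeakSpace ℝ Z '' U ∩ toWeakSpace ℝ Z '' (Y : Set Z)
  have hQ : IsCompact Q := IsCompact.inter_right hU hYclosed
  have : CompactSpace Q := isCompact_iff_compactSpace.1 hQ
  have heval : ∀ f : StrongDual ℝ Z,
      Continuous fun w : WeakSpace ℝ Z => f ((toWeakSpace ℝ Z).symm w) :=
    fun f => WeakBilin.eval_continuous (topDualPairing ℝ Z).flip f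
  have : TopologicalSpace.MetrizableSpace Q :=
    Metric.PiNatEmbed.TopologicalSpace.MetrizableSpace.of_countable_separating
      (fun n w => g n ((toWeakSpace ℝ Z).symm w.1))
      (fun n => (heval (g n)).comp continuous_subtype_val) (by
        rintro ⟨_, _, a, ha, rfl⟩ ⟨_, _, b, hb, rfl⟩ hab
        contrapose! hab
        simp only [LinearEquiv.symm_apply_apply] at hab
        have := hg (a - b) (Y.sub_mem ha hb) fun n => by rw [map_sub, hab n, sub_self]
        simp only [sub_eq_zero.1 this])
  obtain ⟨⟨_, ⟨z, hz, rfl⟩, _⟩, ψ, hψ, hlim⟩ := CompactSpace.tendsto_subseq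
    fun n => (⟨toWeakSpace ℝ Z (s n), mem_image_of_mem _ (hs n), mem_image_of_mem _ (hsY n)⟩ : Q)
  refine ⟨z, hz, ψ, hψ, fun f => ?_⟩
  exact (((heval f).comp continuous_subtype_val).tendsto _).comp hlim

/-- A convex function that is norm continuous on `C` is weakly sequentially lower semicontinuous
relative to `C`. The set `C` need not be closed. -/
theorem le_of_weakTendsto_of_convexOn {C : Set Z} {F : Z → ℝ} (hF : ConvexOn ℝ C F)
    (hFc : ContinuousOn F C) {s : ℕ → Z} {z : Z} {r : ℝ} (hs : ∀ n, s n ∈ C) (hz : z ∈ C)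
    (hlim : WeakTendsto s z) (hr : ∀ᶠ n in atTop, F (s n) ≤ r) : F z ≤ r := by
  have hconv := hF.convex_le r
  have hzcl : z ∈ closure {u ∈ C | F u ≤ r} := by
    by_contra hcon
    obtain ⟨f, a, hfa, haz⟩ :=
      geometric_hahn_banach_closed_point hconv.closure isClosed_closure hcon
    refine absurd (le_of_tendsto (hlim f) (hr.mono fun n hn => ?_)) (not_le.2 haz)
    exact (hfa _ (subset_closure ⟨hs n, hn⟩)).le
  have := mem_closure_iff_nhdsWithin_neBot.1 hzcl
  exact le_of_tendsto ((hFc z hz).mono (sep_subset _ _))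
    (eventually_mem_nhdsWithin.mono fun u hu => hu.2)

end WeakTopology

/-! ### The optimal control problem -/

/-- The direct method: a function on a sequentially compact set, lower semicontinuous along the
extracted subsequences, attains its infimum. -/
theorem exists_isMinOn_of_seq {α : Type*} {U : Set α} (hne : U.Nonempty) (J : α → ℝ)
    (h : ∀ s : ℕ → α, (∀ n, s n ∈ U) → ∃ z ∈ U, ∃ ψ : ℕ → ℕ, StrictMono ψ ∧
      ∀ r : ℝ, (∀ᶠ n in atTop, J (s (ψ n)) ≤ r) → J z ≤ r) :
    ∃ z ∈ U, ∀ y ∈ U, J z ≤ J y := by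
  -- The infimum is taken in `EReal` because `J` is not yet known to be bounded below.
  let I : Set EReal := (fun a => (J a : EReal)) '' U
  obtain ⟨t, -, ht, htI⟩ := exists_seq_tendsto_sInf (S := I) (hne.image _) (OrderBot.bddBelow _)
  choose s hsU hst using htI
  obtain ⟨z, hz, ψ, hψ, hJ⟩ := h s hsU
  refine ⟨z, hz, fun y hy => ?_⟩
  have hle : ((J z : ℝ) : EReal) ≤ sInf I := by
    refine le_of_forall_gt_imp_ge_of_dense fun b hb => ?_
    obtain ⟨r, hr1, hr2⟩ := EReal.lt_iff_exists_real_btwn.1 hb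
    refine (EReal.coe_le_coe_iff.2 (hJ r ?_)).trans hr2.le
    filter_upwards [(ht.comp hψ.tendsto_atTop).eventually_lt_const hr1] with n hn
    rw [Function.comp_apply, ← hst (ψ n), EReal.coe_lt_coe_iff] at hn
    exact hn.le
  exact EReal.coe_le_coe_iff.1 (hle.trans (sInf_le (mem_image_of_mem _ hy)))

section Control

variable {Z : Type u} [NormedAddCommGroup Z] [NormedSpace ℝ Z]

/-- Unique solvability and existence of an optimal pair under the hypotheses common to both
settings; compactness of `K` is not needed. -/
theorem existsUnique_state_and_exists_isOptimalPair {C U : Set Z} (hUC : U ⊆ C)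
    (hne : U.Nonempty) (hU : IsWeaklyCompact U)
    {X : Type v} [NormedAddCommGroup X] [NormedSpace ℝ X] (hX : IsReflexive X)
    {K : StrongDual ℝ X →ₗ[ℝ] X} {N : X → StrongDual ℝ X} {H : Z → X} {φ : Z → X → ℝ} {d : ℝ}
    (hd : 0 < d) (hK : ∀ f : StrongDual ℝ X, d * ‖K f‖ ^ 2 ≤ f (K f)) (hNc : Continuous N)
    (hNb : ∀ S : Set X, Bornology.IsBounded S → Bornology.IsBounded (N '' S))
    (hN : ∀ x y, (N x - N y) (x - y) ≤ 0) (hH : CompletelyContinuousOn H U)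
    (hφ : CostAssumption C U φ) :
    (∀ u ∈ U, ∃! x : X, StateEq K N H u x) ∧
      ∃ (u : Z) (x : X), IsOptimalPair K N H U φ u x := by
  have hex : ∀ u, ∃! x : X, StateEq K N H u x := fun u =>
    existsUnique_eq_map_add hX hd hK hNc hNb hN (H u)
  refine ⟨fun u _ => hex u, ?_⟩
  choose T hT hTuniq using hex
  obtain ⟨z, hz, hmin⟩ := exists_isMinOn_of_seq hne (fun u => φ u (T u)) fun s hs => by
    obtain ⟨z, hz, ψ, hψ, hlim⟩ := hU.exists_weakTendsto_subseq hs
    have hTlim : Tendsto (fun n => T (s (ψ n))) atTop (𝓝 (T z)) :=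
      tendsto_of_tendsto_rhs hd hK hNc hNb hN (fun n => hT (s (ψ n))) (hT z)
        (hH (s ∘ ψ) z (fun n => hs (ψ n)) hz hlim)
    refine ⟨z, hz, ψ, hψ, fun r hr => le_of_forall_pos_le_add fun ε hε => ?_⟩
    obtain ⟨δ, hδ, hφδ⟩ := hφ.continuous_state (T z) ε hε
    refine le_of_weakTendsto_of_convexOn (hφ.convex (T z)) (hφ.continuous_control (T z))
      (fun n => hUC (hs (ψ n))) (hUC hz) hlim ?_
    filter_upwards [hr, (tendsto_iff_norm_sub_tendsto_zero.1 hTlim).eventually_lt_const hδ]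
      with n hn hnδ
    have := (abs_lt.1 (hφδ _ (hs (ψ n)) _ hnδ)).1
    change φ (s (ψ n)) (T z) ≤ r + ε
    linarith
  refine ⟨z, T z, hz, hT z, fun u hu x hx => ?_⟩
  rw [hTuniq u x hx]
  exact hmin u hu

end Control

/-! ### Strongly monotone operators on a Hilbert space -/

section Hilbert

variable {E : Type v} [NormedAddCommGroup E] [InnerProductSpace ℝ E]

/-- The Riesz identification of a real Hilbert space with its dual, as an `ℝ`-linear isometry
(`InnerProductSpace.toDual` is conjugate-linear, which over `ℝ` is only propositionally linear). -/
noncomputable def rieszEquiv (E : Type v) [NormedAddCommGroup E] [InnerProductSpace ℝ E]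
    [CompleteSpace E] : E ≃ₗᵢ[ℝ] StrongDual ℝ E where
  toFun := InnerProductSpace.toDual ℝ E
  invFun := (InnerProductSpace.toDual ℝ E).symm
  left_inv := (InnerProductSpace.toDual ℝ E).left_inv
  right_inv := (InnerProductSpace.toDual ℝ E).right_inv
  map_add' := map_add _
  map_smul' r x := by simp
  norm_map' := (InnerProductSpace.toDual ℝ E).norm_map

theorem rieszEquiv_apply [CompleteSpace E] (x y : E) : rieszEquiv E x y = inner ℝ x y := rfl

theorem isReflexive_of_innerProductSpace [CompleteSpace E] : IsReflexive E := by
  intro ξ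
  let J := rieszEquiv E
  let η : StrongDual ℝ E := ξ.comp (J.toContinuousLinearEquiv : E →L[ℝ] StrongDual ℝ E)
  refine ⟨J.symm η, ?_⟩
  ext f
  obtain ⟨x, rfl⟩ := J.surjective f
  rw [NormedSpace.dual_def, rieszEquiv_apply, real_inner_comm, ← rieszEquiv_apply]
  exact congrArg (fun g => g x) (J.apply_symm_apply η)

/-- An everywhere defined monotone linear operator is bounded, by the closed graph theorem. -/
theorem continuous_of_monotone_linear [CompleteSpace E] {K : E →ₗ[ℝ] E}
    (hK : ∀ x, 0 ≤ inner ℝ (K x) x) : Continuous K := by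
  refine K.continuous_of_seq_closed_graph fun s x y hs hKs => ?_
  have key : ∀ z, 0 ≤ inner ℝ (y - K z) (x - z) := fun z =>
    ge_of_tendsto' ((hKs.sub_const (K z)).inner (hs.sub_const z)) fun n => by
      simpa using hK (s n - z)
  have hlim : Tendsto (fun t : ℝ => inner ℝ (y - K x + t • K (y - K x)) (y - K x)) (𝓝[<] 0)
      (𝓝 (inner ℝ (y - K x) (y - K x))) := by
    have : Continuous fun t : ℝ => inner ℝ (y - K x + t • K (y - K x)) (y - K x) := by fun_prop
    simpa using (this.tendsto 0).mono_left nhdsWithin_le_nhds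
  have hle : inner ℝ (y - K x) (y - K x) ≤ (0 : ℝ) := by
    refine le_of_tendsto hlim ?_
    filter_upwards [self_mem_nhdsWithin] with t ht
    have h := key (x - t • (y - K x))
    rw [sub_sub_cancel, inner_smul_right, map_sub, map_smul, ← sub_add] at h
    exact nonpos_of_mul_nonneg_right h ht
  exact sub_eq_zero.1 (inner_self_eq_zero.1 (hle.antisymm real_inner_self_nonneg))

/-- Positivity of `mu F` excludes the junk value `0` of an unbounded infimum, so that `mu F` is a
genuine lower bound of the quotients. -/
theorem inner_sub_nonneg_of_mu_pos {F : E → E} (h : 0 < mu F) (x y : E) :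
    0 ≤ inner ℝ (F x - F y) (x - y) := by
  rcases eq_or_ne x y with rfl | hxy
  · simp
  have hbdd : BddBelow
      {r : ℝ | ∃ x y : E, x ≠ y ∧ r = inner ℝ (F x - F y) (x - y) / ‖x - y‖ ^ 2} := by
    by_contra hcon
    exact h.ne' (Real.sInf_of_not_bddBelow hcon)
  have hle := h.trans_le (csInf_le hbdd ⟨x, y, hxy, rfl⟩)
  have hpos : 0 < ‖x - y‖ ^ 2 := pow_pos (norm_pos_iff.2 (sub_ne_zero.2 hxy)) 2
  exact ((div_pos_iff_of_pos_right hpos).1 hle).le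

/-- Strong monotonicity of a linear `K` gives `d ‖K x‖² ≤ ⟨K x, x⟩`, since `K` is bounded. -/
theorem ClassM.exists_mul_norm_sq_le [CompleteSpace E] {K : E →ₗ[ℝ] E}
    (hK : ClassM (K : E → E)) : ∃ d : ℝ, 0 < d ∧ ∀ x, d * ‖K x‖ ^ 2 ≤ inner ℝ (K x) x := by
  obtain ⟨c, hc, hKc⟩ := hK
  have hKc' : ∀ x, c * ‖x‖ ^ 2 ≤ inner ℝ (K x) x := fun x => by simpa using hKc x 0
  -- The `+ 1` in the constant covers the case `‖K‖ = 0`.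
  let K' : E →L[ℝ] E := ⟨K, continuous_of_monotone_linear fun x => (by positivity :
    0 ≤ c * ‖x‖ ^ 2).trans (hKc' x)⟩
  refine ⟨c / (‖K'‖ ^ 2 + 1), by positivity, fun x => le_trans ?_ (hKc' x)⟩
  have h1 : ‖K x‖ ^ 2 ≤ (‖K'‖ * ‖x‖) ^ 2 :=
    pow_le_pow_left₀ (norm_nonneg _) (K'.le_opNorm x) 2
  rw [div_mul_eq_mul_div, div_le_iff₀ (by positivity), mul_assoc]
  refine mul_le_mul_of_nonneg_left ?_ hc.le
  nlinarith [sq_nonneg ‖x‖]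

end Hilbert
end Hammerstein

theorem mainTheorem1 {Z : Type u} [NormedAddCommGroup Z] [NormedSpace ℝ Z] [CompleteSpace Z]
    (hZ : Hammerstein.IsReflexive Z)
    (C U : Set Z) (hC : Convex ℝ C) (hUC : U ⊆ C)
    (hne : U.Nonempty) (hU : Hammerstein.IsWeaklyCompact U) :
    (∀ (X : Type v) [NormedAddCommGroup X] [NormedSpace ℝ X] [CompleteSpace X],
      Hammerstein.IsReflexive X →
      ∀ (K : StrongDual ℝ X →ₗ[ℝ] X) (N : X → StrongDual ℝ X) (H : Z → X) (φ : Z → X → ℝ),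
        Hammerstein.AssumptionA U K N H → Hammerstein.CostAssumption C U φ →
          (∀ u ∈ U, ∃! x : X, Hammerstein.StateEq K N H u x) ∧
          ∃ (u : Z) (x : X), Hammerstein.IsOptimalPair K N H U φ u x) ∧
    (∀ (E : Type v) [NormedAddCommGroup E] [InnerProductSpace ℝ E] [CompleteSpace E],
      ∀ (K : E →ₗ[ℝ] E) (N : E → E) (H : Z → E) (φ : Z → E → ℝ),
        Hammerstein.AssumptionB U K N H → Hammerstein.CostAssumption C U φ →
          (∀ u ∈ U, ∃! x : E, Hammerstein.StateEq K N H u x) ∧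
          ∃ (u : Z) (x : E), Hammerstein.IsOptimalPair K N H U φ u x) := by
  refine ⟨fun X _ _ _ hX K N H φ hA hφ => ?_, fun E _ _ _ K N H φ hB hφ => ?_⟩
  · obtain ⟨d, hd, hK⟩ := hA.positive
    exact Hammerstein.existsUnique_state_and_exists_isOptimalPair hUC hne hU hX hd hK
      hA.continuous hA.bounded hA.negMonotone hA.completelyContinuous hφ
  · let J := Hammerstein.rieszEquiv E
    obtain ⟨d, hd, hK⟩ := hB.classM.exists_mul_norm_sq_le
    obtain ⟨L, hL⟩ := hB.lipschitz
    have hLip : LipschitzWith L.toNNReal N := LipschitzWith.of_dist_le_mul fun x y => by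
      rw [dist_eq_norm, dist_eq_norm]
      exact (hL x y).trans (mul_le_mul_of_nonneg_right (Real.le_coe_toNNReal L) (norm_nonneg _))
    have hJN : LipschitzWith (1 * L.toNNReal) fun x => J (N x) := J.lipschitz.comp hLip
    have key := Hammerstein.existsUnique_state_and_exists_isOptimalPair
      (K := K ∘ₗ (J.symm.toLinearEquiv : StrongDual ℝ E →ₗ[ℝ] E))
      (N := fun x => J (N x)) (H := H) (φ := φ)
      hUC hne hU Hammerstein.isReflexive_of_innerProductSpace hd
      (fun f => by
        obtain ⟨x, rfl⟩ := J.surjective f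
        have h := hK x
        rw [real_inner_comm] at h
        simpa [J, Hammerstein.rieszEquiv_apply] using h)
      hJN.continuous (fun S hS => hJN.isBounded_image hS)
      (fun x y => by
        have h := Hammerstein.inner_sub_nonneg_of_mu_pos hB.mu_neg_pos x y
        have h' : (-N) x - (-N) y = -(N x - N y) := by simp only [Pi.neg_apply]; abel
        rw [h', inner_neg_left] at h
        rw [← map_sub]
        exact neg_nonneg.1 h)
      hB.completelyContinuous hφ
    have hst : Hammerstein.StateEq (⇑(K ∘ₗ (J.symm.toLinearEquiv : StrongDual ℝ E →ₗ[ℝ] E)))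
        (fun x => J (N x)) H = Hammerstein.StateEq (⇑K) N H := by
      funext u x
      simp [Hammerstein.StateEq]
    simpa only [Hammerstein.IsOptimalPair, hst] using key
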